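/- For $x\in\mathbb R^3$ and $r>0$ let $B_r(x)=\{y\in\mathbb R^3:|x-y|<r\}$. For $\sigma\in[0,1]$ let $L^{\sigma,2}(B_r(x))$ be the space of tempered distributions $f$ on $\mathbb R^3$ with $\operatorname{supp} f\subset\overline{B_r(x)}$ whose Fourier transform is a locally integrable function with $$\|f\|_{\dot H^\sigma(\mathbb R^3)}=\Big(\int_{\mathbb R^3}|\xi|^{2\sigma}|\hat f(\xi)|^2\,d\xi\Big)^{1/2}<\infty .$$ Equip $L^{\sigma,2}(B_r(x))$ with this norm and let $L^{-\sigma,2}(B_r(x))$ be its dual space with the dual norm. A locally integrable function $h$ on $B_r(x)$ is regarded as an element of $L^{-\sigma,2}(B_r(x))$ if there is a bounded linear functional on $L^{\sigma,2}(B_r(x))$ that maps each $\varphi\in C_c^\infty(B_r(x))$ to $\int_{B_r(x)}h\varphi\,dy$; then $\|h\|_{L^{-\sigma,2}(B_r(x))}$ is the norm of this functional, and otherwise $\|h\|_{L^{-\sigma,2}(B_r(x))}=\infty$. **Lemma 4.1.** There is an absolute constant $C>0$ such that for all $\sigma\in[0,1]$, $x_0\in\mathbb R^3$ and $r>0$,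 and every (real- or complex-valued) harmonic function $h$ in $B_{2r}(x_0)$, $$\|h\|_{L^2(B_r(x_0))}\le C\,\Big\|\frac{h}{r^\sigma}\Big\|_{L^{-\sigma,2}(B_{2r}(x_0))}.$$ -/

import Mathlib

open MeasureTheory Metric
open scoped ENNReal NNReal FourierTransform SchwartzMap

/-- Three-dimensional Euclidean space. -/
abbrev E3 : Type := EuclideanSpace ℝ (Fin 3)

/-- The Fourier transform of the tempered distribution `f` on `ℝ³` is the locally integrable
function `g`. -/
def HasFourierDensity (f : 𝓢'(E3, ℂ)) (g : E3 → ℂ) : Prop :=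
  LocallyIntegrable g volume ∧
    ∀ φ : 𝓢(E3, ℂ), HasCompactSupport φ → (𝓕 f) φ = ∫ ξ, g ξ * φ ξ

/-- The weighted Fourier transform `|ξ|^σ g(ξ)`. -/
noncomputable def fourierWeight (σ : ℝ) (g : E3 → ℂ) : E3 → ℂ :=
  fun ξ ↦ ((‖ξ‖ ^ σ : ℝ) : ℂ) * g ξ

/-- The homogeneous Sobolev norm `(∫ |ξ|^{2σ} |𝓕 f (ξ)|² dξ)^{1/2}` of a tempered distribution
on `ℝ³`. It is `∞` if the Fourier transform is not a locally integrable function; otherwise the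
function representing it is unique up to null sets, and the infimum is its weighted norm. -/
noncomputable def homSobolevNorm (σ : ℝ) (f : 𝓢'(E3, ℂ)) : ℝ≥0∞ :=
  ⨅ (g : E3 → ℂ) (_ : HasFourierDensity f g), eLpNorm (fourierWeight σ g) 2 volume

lemma integrable_mul_of_hasCompactSupport {g : E3 → ℂ} (hg : LocallyIntegrable g volume)
    {φ : 𝓢(E3, ℂ)} (hφ : HasCompactSupport φ) : Integrable (fun ξ ↦ g ξ * φ ξ) volume := by
  simpa [mul_comm] using hg.integrable_smul_left_of_hasCompactSupport φ.continuous hφ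

lemma HasFourierDensity.add {f₁ f₂ : 𝓢'(E3, ℂ)} {g₁ g₂ : E3 → ℂ}
    (h₁ : HasFourierDensity f₁ g₁) (h₂ : HasFourierDensity f₂ g₂) :
    HasFourierDensity (f₁ + f₂) (g₁ + g₂) := by
  refine ⟨h₁.1.add h₂.1, fun φ hφ ↦ ?_⟩
  have e : (𝓕 (f₁ + f₂)) φ = (𝓕 f₁) φ + (𝓕 f₂) φ := rfl
  rw [e, h₁.2 φ hφ, h₂.2 φ hφ, ← integral_add
    (integrable_mul_of_hasCompactSupport h₁.1 hφ) (integrable_mul_of_hasCompactSupport h₂.1 hφ)]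
  simp [add_mul]

lemma HasFourierDensity.smul (c : ℂ) {f : 𝓢'(E3, ℂ)} {g : E3 → ℂ}
    (h : HasFourierDensity f g) : HasFourierDensity (c • f) (c • g) := by
  refine ⟨h.1.smul c, fun φ hφ ↦ ?_⟩
  have e : (𝓕 (c • f)) φ = c * (𝓕 f) φ := rfl
  rw [e, h.2 φ hφ, ← integral_const_mul]
  simp [mul_assoc]

lemma hasFourierDensity_zero : HasFourierDensity 0 0 :=
  ⟨locallyIntegrable_zero, fun φ _ ↦ by simp⟩

lemma fourierWeight_add (σ : ℝ) (g₁ g₂ : E3 → ℂ) :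
    fourierWeight σ (g₁ + g₂) = fourierWeight σ g₁ + fourierWeight σ g₂ := by
  ext ξ; simp [fourierWeight, mul_add]

lemma fourierWeight_smul (σ : ℝ) (c : ℂ) (g : E3 → ℂ) :
    fourierWeight σ (c • g) = c • fourierWeight σ g := by
  ext ξ; simp [fourierWeight]; ring

lemma aestronglyMeasurable_fourierWeight (σ : ℝ) {g : E3 → ℂ}
    (hg : LocallyIntegrable g volume) : AEStronglyMeasurable (fourierWeight σ g) volume := by
  refine AEStronglyMeasurable.mul ?_ hg.aestronglyMeasurable
  exact (Complex.measurable_ofReal.comp (measurable_norm.pow_const σ)).aestronglyMeasurable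

lemma homSobolevNorm_lt_top_iff {σ : ℝ} {f : 𝓢'(E3, ℂ)} : homSobolevNorm σ f < ∞ ↔
    ∃ g, HasFourierDensity f g ∧ MemLp (fourierWeight σ g) 2 volume := by
  simp only [homSobolevNorm, iInf_lt_iff, MemLp]
  exact ⟨fun ⟨g, h, h'⟩ ↦ ⟨g, h, aestronglyMeasurable_fourierWeight σ h.1, h'⟩,
    fun ⟨g, h, h'⟩ ↦ ⟨g, h, h'.2⟩⟩

/-- The space `L^{σ,2}(B_r(x))` of all tempered distributions of finite homogeneous Sobolev norm
of order `σ` on `ℝ³` whose support lies in the closed ball of centre `x` and radius `r`. -/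
noncomputable def sobolevBall (σ : ℝ) (x : E3) (r : ℝ) : Submodule ℂ 𝓢'(E3, ℂ) where
  carrier := {f | homSobolevNorm σ f < ∞ ∧ Distribution.dsupport f ⊆ closedBall x r}
  zero_mem' := by
    refine ⟨homSobolevNorm_lt_top_iff.2 ⟨0, hasFourierDensity_zero, ?_⟩, ?_⟩
    · have : fourierWeight σ 0 = 0 := by ext ξ; simp [fourierWeight]
      rw [this]; exact MemLp.zero
    · intro y hy
      rw [Distribution.mem_dsupport_iff] at hy
      exact (hy ∅ (fun _ _ ↦ rfl) isClosed_empty).elim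
  add_mem' := by
    rintro f₁ f₂ ⟨h₁, s₁⟩ ⟨h₂, s₂⟩
    obtain ⟨g₁, d₁, m₁⟩ := homSobolevNorm_lt_top_iff.1 h₁
    obtain ⟨g₂, d₂, m₂⟩ := homSobolevNorm_lt_top_iff.1 h₂
    refine ⟨homSobolevNorm_lt_top_iff.2 ⟨g₁ + g₂, d₁.add d₂, ?_⟩, ?_⟩
    · rw [fourierWeight_add]; exact m₁.add m₂
    · intro y hy
      by_contra hy'
      obtain ⟨t₁, v₁, o₁, y₁⟩ := (Distribution.notMem_dsupport_iff y).1 (fun h ↦ hy' (s₁ h))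
      obtain ⟨t₂, v₂, o₂, y₂⟩ := (Distribution.notMem_dsupport_iff y).1 (fun h ↦ hy' (s₂ h))
      refine (Distribution.notMem_dsupport_iff y).2
        ⟨t₁ ∩ t₂, fun u hu ↦ ?_, o₁.inter o₂, ⟨y₁, y₂⟩⟩ hy
      have e : (f₁ + f₂) u = f₁ u + f₂ u := rfl
      rw [e, v₁ u (hu.trans Set.inter_subset_left), v₂ u (hu.trans Set.inter_subset_right),
        add_zero]
  smul_mem' := by
    rintro c f ⟨h, s⟩
    obtain ⟨g, d, m⟩ := homSobolevNorm_lt_top_iff.1 h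
    refine ⟨homSobolevNorm_lt_top_iff.2 ⟨c • g, d.smul c, ?_⟩, ?_⟩
    · rw [fourierWeight_smul]; exact m.const_smul c
    · refine (Distribution.dsupport_subset_dsupport fun t _ ht u hu ↦ ?_).trans s
      have e : (c • f) u = c * f u := rfl
      rw [e, ht u hu, mul_zero]

/-- The dual norm of a linear functional on `L^{σ,2}(B_r(x))`, with value `∞` if the functional is
unbounded. The functional lies in the dual space `L^{-σ,2}(B_r(x))` iff this norm is finite. -/
noncomputable def dualNorm {σ : ℝ} {x : E3} {r : ℝ} (ℓ : sobolevBall σ x r →ₗ[ℂ] ℂ) : ℝ≥0∞ :=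
  ⨆ (u : sobolevBall σ x r) (_ : homSobolevNorm σ (u : 𝓢'(E3, ℂ)) ≤ 1), ‖ℓ u‖ₑ

/-- The functional `ℓ` on `L^{σ,2}(B_r(x))` is the function `h` on the open ball `B_r(x)`: it acts
as `φ ↦ ∫ h φ` on all smooth `φ` with compact support in that ball. -/
def RepresentedBy {σ : ℝ} {x : E3} {r : ℝ} (ℓ : sobolevBall σ x r →ₗ[ℂ] ℂ) (h : E3 → ℂ) : Prop :=
  LocallyIntegrableOn h (ball x r) volume ∧
    ∀ φ : 𝓢(E3, ℂ), HasCompactSupport φ → tsupport φ ⊆ ball x r →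
      ∀ u : sobolevBall σ x r, (u : 𝓢'(E3, ℂ)) = (φ : 𝓢'(E3, ℂ)) →
        ℓ u = ∫ y in ball x r, h y * φ y

/-- The norm of a function `h` in the dual `L^{-σ,2}(B_r(x))` of `L^{σ,2}(B_r(x))`, with value `∞`
if `h` is not an element of the dual, that is, not represented by any bounded functional. -/
noncomputable def negSobolevNorm (σ : ℝ) (x : E3) (r : ℝ) (h : E3 → ℂ) : ℝ≥0∞ :=
  ⨅ (ℓ : sobolevBall σ x r →ₗ[ℂ] ℂ) (_ : RepresentedBy ℓ h), dualNorm ℓ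

/-! A harmonic function is recovered from its action on test functions: for `y` in the ball of
radius `r`, integrating `h` against a radial bump of radius `s = r / 2` about `y` gives `s ^ 3 * c *
h y`, with `c > 0` fixed (`integral_harmonic_mul_radialBump`). This bump is an admissible test
function in the ball of radius `2 * r`, and by scaling its Sobolev norm of order `σ` is at most `s ^
(3 / 2 - σ) * K`, with `K` independent of `σ` (`eLpNorm_fourierWeight_dilation`,
`exists_eLpNorm_fourierWeight_le`). The factor `r ^ σ` cancels `s ^ (-σ)` up to `2 ^ σ ≤ 2`, so `|h
y|` is at most `D * r ^ (-3 / 2)` times the dual norm (`exists_enorm_harmonic_le`). Taking the `L²`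
norm over a ball of volume proportional to `r ^ 3` removes the power of `r`.

The weighted mean value property follows by differentiating `∫ H (y + s • z) g(|z|²)` in `s`. If `f'
= g`, then `z g(|z|²)` is half the gradient of `f(|z|²)`, and integration by parts turns the
derivative into an integral of the Laplacian of `H`. -/

/-! ### The mean value property with radial weights -/

section MeanValue

variable {E : Type*} [NormedAddCommGroup E] [InnerProductSpace ℝ E]

lemma hasFDerivAt_comp_norm_sq {f : ℝ → ℝ} {f' : ℝ} {z : E} (hf : HasDerivAt f f' (‖z‖ ^ 2)) :
    HasFDerivAt (fun z : E ↦ f (‖z‖ ^ 2)) (f' • (2 • innerSL ℝ z)) z :=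
  hf.comp_hasFDerivAt z (hasStrictFDerivAt_norm_sq z).hasFDerivAt

variable [FiniteDimensional ℝ E]

lemma hasCompactSupport_comp_norm_sq {f : ℝ → ℝ} (hf : ∀ t, 1 ≤ t → f t = 0) :
    HasCompactSupport fun z : E ↦ f (‖z‖ ^ 2) := by
  refine HasCompactSupport.intro (isCompact_closedBall (0 : E) 1) fun z hz ↦ hf _ ?_
  have : 1 < ‖z‖ := by simpa using hz
  nlinarith

variable [MeasurableSpace E] [BorelSpace E]

/-- Integration by parts of the gradient of a harmonic function against the gradient of a radial
function of compact support. -/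
lemma integral_fderiv_apply_mul_radial_eq_zero {f g : ℝ → ℝ}
    (hfg : ∀ t, HasDerivAt f (g t) t) (hg : Continuous g) (hf1 : ∀ t, 1 ≤ t → f t = 0)
    (hg1 : ∀ t, 1 ≤ t → g t = 0) {H : E → ℂ} (hH : ContDiff ℝ 2 H) {y : E} {R s : ℝ}
    (hs : 0 ≤ s) (hsR : s ≤ R) (hΔ : ∀ z ∈ closedBall y R, Laplacian.laplacian H z = 0) :
    ∫ z : E, fderiv ℝ H (y + s • z) z * (g (‖z‖ ^ 2) : ℂ) = 0 := by
  let b := stdOrthonormalBasis ℝ E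
  have hfc : Continuous f := continuous_iff_continuousAt.2 fun t ↦ (hfg t).continuousAt
  have hD : ContDiff ℝ 1 (fderiv ℝ H) := hH.fderiv_right (by norm_num)
  have hDc := hD.continuous
  have hDDc : Continuous (fderiv ℝ (fderiv ℝ H)) := hD.continuous_fderiv (by norm_num)
  have hcg : HasCompactSupport fun z : E ↦ (g (‖z‖ ^ 2) : ℂ) :=
    (hasCompactSupport_comp_norm_sq hg1).comp_left (g := ((↑) : ℝ → ℂ)) Complex.ofReal_zero
  have hcf : HasCompactSupport fun z : E ↦ (f (‖z‖ ^ 2) : ℂ) :=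
    (hasCompactSupport_comp_norm_sq hf1).comp_left (g := ((↑) : ℝ → ℂ)) Complex.ofReal_zero
  have hgc : Continuous fun z : E ↦ (g (‖z‖ ^ 2) : ℂ) := by fun_prop
  have hfc' : Continuous fun z : E ↦ (f (‖z‖ ^ 2) : ℂ) := by fun_prop
  have hint1 : ∀ v : E, ∀ L : E →L[ℝ] ℝ, Integrable
      fun z : E ↦ fderiv ℝ H (y + s • z) v * ((L z : ℝ) * (g (‖z‖ ^ 2) : ℂ)) := by
    intro v L
    refine Continuous.integrable_of_hasCompactSupport (by fun_prop) ?_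
    exact (hcg.mul_left).mul_left
  have hint2 : ∀ v : E, Integrable
      fun z : E ↦ fderiv ℝ (fderiv ℝ H) (y + s • z) v v * (f (‖z‖ ^ 2) : ℂ) := by
    intro v
    exact Continuous.integrable_of_hasCompactSupport (by fun_prop) hcf.mul_left
  have hint3 : ∀ v : E, Integrable
      fun z : E ↦ fderiv ℝ H (y + s • z) v * (f (‖z‖ ^ 2) : ℂ) := by
    intro v
    exact Continuous.integrable_of_hasCompactSupport (by fun_prop) hcf.mul_left
  -- The derivative of `f(|z|²)` along `v` is `2⟨z, v⟩ g(|z|²)`, which gives the factor `1 / 2`; the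
  -- factor `s` is the chain rule in `y + s • z`.
  have key : ∀ v : E, ∫ z : E, fderiv ℝ H (y + s • z) v * ((inner ℝ z v : ℝ) * (g (‖z‖ ^ 2) : ℂ))
      = - ((s / 2 : ℝ) * ∫ z : E, fderiv ℝ (fderiv ℝ H) (y + s • z) v v * (f (‖z‖ ^ 2) : ℂ)) := by
    intro v
    have hA : ∀ z : E, HasFDerivAt (fun z : E ↦ fderiv ℝ H (y + s • z) v)
        (s • (ContinuousLinearMap.apply ℝ ℂ v ∘L fderiv ℝ (fderiv ℝ H) (y + s • z))) z := by
      intro z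
      have h1 : HasFDerivAt (fun z : E ↦ y + s • z) (s • ContinuousLinearMap.id ℝ E) z :=
        ((hasFDerivAt_id z).const_smul s).const_add y
      have h2 := ((hD.differentiable (by norm_num)) (y + s • z)).hasFDerivAt.comp z h1
      have h3 := (ContinuousLinearMap.apply ℝ ℂ v).hasFDerivAt.comp z h2
      refine (show HasFDerivAt (fun z : E ↦ fderiv ℝ H (y + s • z) v) _ z from h3).congr_fderiv ?_
      ext w
      simp
    have hB : ∀ z : E, HasFDerivAt (fun z : E ↦ (f (‖z‖ ^ 2) : ℂ))
        (Complex.ofRealCLM ∘L (g (‖z‖ ^ 2) • (2 • innerSL ℝ z))) z := fun z ↦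
      Complex.ofRealCLM.hasFDerivAt.comp z (hasFDerivAt_comp_norm_sq (hfg _))
    have := integral_bilinear_hasFDerivAt_right_eq_neg_left_of_integrable (μ := volume) (v := v)
      (B := ContinuousLinearMap.mul ℝ ℂ) (f := fun z : E ↦ fderiv ℝ H (y + s • z) v)
      (g := fun z : E ↦ (f (‖z‖ ^ 2) : ℂ)) ?_ ?_ ?_ (fun z _ ↦ hA z) (fun z _ ↦ hB z)
    · have e1 : ∀ z : E, ContinuousLinearMap.mul ℝ ℂ (fderiv ℝ H (y + s • z) v)
          ((Complex.ofRealCLM ∘L (g (‖z‖ ^ 2) • (2 • innerSL ℝ z))) v) =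
          2 * (fderiv ℝ H (y + s • z) v * ((inner ℝ z v : ℝ) * (g (‖z‖ ^ 2) : ℂ))) := by
        intro z; simp; ring
      have e2 : ∀ z : E, ContinuousLinearMap.mul ℝ ℂ
          ((s • (ContinuousLinearMap.apply ℝ ℂ v ∘L fderiv ℝ (fderiv ℝ H) (y + s • z))) v)
          (f (‖z‖ ^ 2) : ℂ) =
          s * (fderiv ℝ (fderiv ℝ H) (y + s • z) v v * (f (‖z‖ ^ 2) : ℂ)) := by
        intro z; simp; ring
      simp only [e1, e2, integral_const_mul] at this
      push_cast
      linear_combination this / 2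
    · refine ((hint2 v).const_mul (s : ℂ)).congr (.of_forall fun z ↦ ?_)
      simp; ring
    · refine ((hint1 v (innerSL ℝ v)).const_mul 2).congr (.of_forall fun z ↦ ?_)
      simp [real_inner_comm]; ring
    · exact hint3 v
  have hsum : ∀ z : E, fderiv ℝ H (y + s • z) z * (g (‖z‖ ^ 2) : ℂ) =
      ∑ i, fderiv ℝ H (y + s • z) (b i) * ((inner ℝ z (b i) : ℝ) * (g (‖z‖ ^ 2) : ℂ)) := by
    intro z
    conv_lhs => rw [← b.sum_repr' z, map_sum, Finset.sum_mul]
    refine Finset.sum_congr rfl fun i _ ↦ ?_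
    rw [b.sum_repr' z, map_smul, Complex.real_smul, real_inner_comm]
    ring
  simp_rw [hsum]
  rw [integral_finsetSum _ fun i _ ↦ ?_]
  · simp_rw [key]
    rw [Finset.sum_neg_distrib, ← Finset.mul_sum, ← integral_finsetSum _ fun i _ ↦ hint2 (b i)]
    have : ∀ z : E, ∑ i, fderiv ℝ (fderiv ℝ H) (y + s • z) (b i) (b i) * (f (‖z‖ ^ 2) : ℂ) = 0 := by
      intro z
      rw [← Finset.sum_mul]
      -- For `‖z‖ ≤ 1` the point `y + s • z` lies where `H` is harmonic; elsewhere the weight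
      -- `f(|z|²)` vanishes.
      rcases le_or_gt ‖z‖ 1 with hz | hz
      · have h0 := hΔ (y + s • z) (by
          simp only [mem_closedBall, dist_self_add_left, norm_smul, Real.norm_eq_abs,
            abs_of_nonneg hs]
          nlinarith [norm_nonneg z])
        rw [InnerProductSpace.laplacian_eq_iteratedFDeriv_orthonormalBasis H b] at h0
        simp only [iteratedFDeriv_two_apply] at h0
        simp at h0
        simp [h0]
      · rw [hf1 _ (by nlinarith)]; simp
    simp [this]
  · refine (hint1 (b i) (innerSL ℝ (b i))).congr (.of_forall fun z ↦ ?_)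
    simp [real_inner_comm]

/-- The mean value property with a smooth radial weight. -/
theorem integral_mul_radial_eq_of_laplacian_eq_zero {f g : ℝ → ℝ}
    (hfg : ∀ t, HasDerivAt f (g t) t) (hg : Continuous g) (hf1 : ∀ t, 1 ≤ t → f t = 0)
    (hg1 : ∀ t, 1 ≤ t → g t = 0) {H : E → ℂ} (hH : ContDiff ℝ 2 H) {y : E} {R : ℝ}
    (hR : 0 ≤ R) (hΔ : ∀ z ∈ closedBall y R, Laplacian.laplacian H z = 0) :
    ∫ z : E, H (y + R • z) * (g (‖z‖ ^ 2) : ℂ) = H y * ∫ z : E, (g (‖z‖ ^ 2) : ℂ) := by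
  have hHc := hH.continuous
  have hDc : Continuous (fderiv ℝ H) := hH.continuous_fderiv (by norm_num)
  have hcg : HasCompactSupport fun z : E ↦ (g (‖z‖ ^ 2) : ℂ) :=
    (hasCompactSupport_comp_norm_sq hg1).comp_left (g := ((↑) : ℝ → ℂ)) Complex.ofReal_zero
  have hgc : Continuous fun z : E ↦ (g (‖z‖ ^ 2) : ℂ) := by fun_prop
  have hderiv : ∀ s : ℝ, HasDerivAt (fun s : ℝ ↦ ∫ z : E, H (y + s • z) * (g (‖z‖ ^ 2) : ℂ))
      (∫ z : E, fderiv ℝ H (y + s • z) z * (g (‖z‖ ^ 2) : ℂ)) s := by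
    intro s
    -- Only `‖z‖ ≤ 1` matters, so a bound on this compact set dominates the derivative for all
    -- parameters near `s`.
    have hK : IsCompact (closedBall s 1 ×ˢ closedBall (0 : E) 1) :=
      (isCompact_closedBall s 1).prod (isCompact_closedBall 0 1)
    obtain ⟨C, hC⟩ := hK.exists_bound_of_continuousOn
      (f := fun p : ℝ × E ↦ fderiv ℝ H (y + p.1 • p.2) p.2) (by fun_prop)
    refine (hasDerivAt_integral_of_dominated_loc_of_deriv_le (μ := volume)
      (bound := fun z : E ↦ C * ‖(g (‖z‖ ^ 2) : ℂ)‖)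
      (F := fun (s : ℝ) (z : E) ↦ H (y + s • z) * (g (‖z‖ ^ 2) : ℂ))
      (F' := fun (s : ℝ) (z : E) ↦ fderiv ℝ H (y + s • z) z * (g (‖z‖ ^ 2) : ℂ))
      (closedBall_mem_nhds s one_pos) ?_ ?_ ?_ ?_ ?_ ?_).2
    · exact .of_forall fun t ↦ Continuous.aestronglyMeasurable (by fun_prop)
    · exact Continuous.integrable_of_hasCompactSupport (by fun_prop) hcg.mul_left
    · exact Continuous.aestronglyMeasurable (by fun_prop)
    · refine .of_forall fun z t ht ↦ ?_
      rw [norm_mul]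
      rcases le_or_gt ‖z‖ 1 with hz | hz
      · gcongr
        exact hC (t, z) ⟨ht, by simpa using hz⟩
      · rw [hg1 _ (by nlinarith)]; simp
    · exact (hgc.integrable_of_hasCompactSupport hcg).norm.const_mul C
    · refine .of_forall fun z t _ ↦ HasDerivAt.mul_const ?_ _
      have h1 : HasDerivAt (fun t : ℝ ↦ y + t • z) z t := by
        simpa using ((hasDerivAt_id t).smul_const z).const_add y
      exact ((hH.differentiable (by norm_num)) (y + t • z)).hasFDerivAt.comp_hasDerivAt t h1
  -- At scale `0` the integral is `H y * ∫ g(|z|²)`; at scale `R` it is the left-hand side.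
  have hconst := constant_of_has_deriv_right_zero (a := 0) (b := R)
    (f := fun s : ℝ ↦ ∫ z : E, H (y + s • z) * (g (‖z‖ ^ 2) : ℂ))
    (fun s _ ↦ (hderiv s).continuousAt.continuousWithinAt) (fun s hs ↦ by
      have := hderiv s
      rw [integral_fderiv_apply_mul_radial_eq_zero hfg hg hf1 hg1 hH hs.1 hs.2.le hΔ] at this
      exact this.hasDerivWithinAt) R ⟨hR, le_rfl⟩
  simpa [integral_const_mul] using hconst

end MeanValue

/-! ### Sobolev norms of Schwartz functions -/

lemma hasFourierDensity_schwartz (φ : 𝓢(E3, ℂ)) :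
    HasFourierDensity (φ : 𝓢'(E3, ℂ)) (𝓕 φ : 𝓢(E3, ℂ)) := by
  refine ⟨(𝓕 φ : 𝓢(E3, ℂ)).continuous.locallyIntegrable, fun ψ _ ↦ ?_⟩
  rw [TemperedDistribution.fourier_toTemperedDistributionCLM_eq, SchwartzMap.coe_apply]
  simp [mul_comm]

lemma dsupport_schwartz_subset (φ : 𝓢(E3, ℂ)) :
    Distribution.dsupport (φ : 𝓢'(E3, ℂ)) ⊆ tsupport φ := by
  intro y hy
  refine (Distribution.mem_dsupport_iff y).1 hy _ (fun u hu ↦ ?_) (isClosed_tsupport _)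
  rw [SchwartzMap.coe_apply]
  refine integral_eq_zero_of_ae (.of_forall fun x ↦ ?_)
  by_cases hx : x ∈ tsupport φ
  · have : u x = 0 := image_eq_zero_of_notMem_tsupport fun h ↦ hu h hx
    simp [this]
  · simp [image_eq_zero_of_notMem_tsupport hx]

/-- The weighted norms of a Schwartz function are bounded uniformly in the order `σ ∈ [0, 1]`. -/
lemma exists_eLpNorm_fourierWeight_le (ψ : 𝓢(E3, ℂ)) :
    ∃ K : ℝ, 0 < K ∧ ∀ σ : ℝ, 0 ≤ σ → σ ≤ 1 →
      eLpNorm (fourierWeight σ ψ) 2 volume ≤ ENNReal.ofReal K := by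
  have hw : Function.HasTemperateGrowth (fun ξ : E3 ↦ ((1 + ‖ξ‖ ^ 2 : ℝ) : ℂ)) := by fun_prop
  -- The weight `1 + |ξ|²` dominates `|ξ|^σ` for every `σ ∈ [0, 1]` at once.
  set χ : 𝓢(E3, ℂ) := SchwartzMap.smulLeftCLM ℂ (fun ξ : E3 ↦ ((1 + ‖ξ‖ ^ 2 : ℝ) : ℂ)) ψ
  have hχ := (χ.memLp 2 volume).2.ne
  refine ⟨(eLpNorm χ 2 volume).toReal + 1, by positivity, fun σ h0 h1 ↦ ?_⟩
  calc eLpNorm (fourierWeight σ ψ) 2 volume ≤ eLpNorm χ 2 volume := by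
        refine eLpNorm_mono fun ξ ↦ ?_
        rw [SchwartzMap.smulLeftCLM_apply_apply hw, fourierWeight, smul_eq_mul, norm_mul, norm_mul,
          Complex.norm_of_nonneg (by positivity), Complex.norm_of_nonneg (by positivity)]
        gcongr
        rcases le_total ‖ξ‖ 1 with h | h
        · have := Real.rpow_le_one (norm_nonneg ξ) h h0
          nlinarith [sq_nonneg ‖ξ‖]
        · have := Real.rpow_le_rpow_of_exponent_le h h1
          rw [Real.rpow_one] at this
          nlinarith
    _ = ENNReal.ofReal (eLpNorm χ 2 volume).toReal := (ENNReal.ofReal_toReal hχ).symm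
    _ ≤ _ := ENNReal.ofReal_le_ofReal (by linarith)

lemma integral_comp_inv_smul_sub {F : Type*} [NormedAddCommGroup F] [NormedSpace ℝ F]
    (G : E3 → F) {s : ℝ} (hs : 0 < s) (y : E3) :
    ∫ v, G (s⁻¹ • (v - y)) = s ^ 3 • ∫ w, G w := by
  rw [integral_sub_right_eq_self (fun v ↦ G (s⁻¹ • v)) y, Measure.integral_comp_inv_smul]
  simp [abs_of_pos hs]

lemma norm_fourier_dilation {ρ φ : 𝓢(E3, ℂ)} {s : ℝ} (hs : 0 < s) {y : E3}
    (hφ : ∀ z, φ z = ρ (s⁻¹ • (z - y))) (ξ : E3) : ‖𝓕 φ ξ‖ = s ^ 3 * ‖𝓕 ρ (s • ξ)‖ := by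
  have e : 𝓕 φ ξ = s ^ 3 • (Real.fourierChar (-inner ℝ y ξ) • 𝓕 ρ (s • ξ)) := by
    rw [SchwartzMap.fourier_coe, SchwartzMap.fourier_coe, Real.fourier_eq, Real.fourier_eq,
      Circle.smul_def, ← integral_smul, ← integral_comp_inv_smul_sub _ hs y]
    refine integral_congr_ae (.of_forall fun v ↦ ?_)
    have : inner ℝ v ξ = inner ℝ y ξ + inner ℝ (s⁻¹ • (v - y)) (s • ξ) := by
      rw [inner_smul_left, inner_smul_right, inner_sub_left]
      simp
      field_simp
      ring
    simp only [hφ, this, neg_add, AddChar.map_add_eq_mul, Circle.smul_def, Circle.coe_mul,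
      smul_eq_mul, mul_assoc]
  rw [e, norm_smul, Circle.norm_smul]
  simp [abs_of_pos hs]

lemma eLpNorm_comp_smul (g : E3 → ℂ) {s : ℝ} (hs : 0 < s) :
    eLpNorm (fun ξ ↦ g (s • ξ)) 2 volume =
      ENNReal.ofReal (s ^ (-(3 / 2) : ℝ)) * eLpNorm g 2 volume := by
  have hemb := (Homeomorph.smulOfNeZero s hs.ne' : E3 ≃ₜ E3).measurableEmbedding
  have := hemb.eLpNorm_map_measure (g := g) (p := 2) (μ := volume)
  have h2 : Measure.map (Homeomorph.smulOfNeZero s hs.ne' : E3 ≃ₜ E3) volume =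
    ENNReal.ofReal |(s ^ Module.finrank ℝ E3)⁻¹| • (volume : Measure E3) :=
      Measure.map_addHaar_smul volume hs.ne'
  rw [h2, eLpNorm_smul_measure_of_ne_top (by simp)] at this
  refine this.symm.trans ?_
  rw [smul_eq_mul]
  congr 1
  rw [ENNReal.ofReal_rpow_of_nonneg (by positivity) (by simp), abs_of_pos (by positivity)]
  congr 1
  rw [← Real.rpow_natCast, ← Real.rpow_neg hs.le, ← Real.rpow_mul hs.le]
  simp
  norm_num

/-- The exponent collects `3` from the Fourier transform of a dilation, `-σ` from the weight and `-3
/ 2` from rescaling the `L²` norm; the translation by `y` contributes only a unimodular phase. -/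
lemma eLpNorm_fourierWeight_dilation {ρ φ : 𝓢(E3, ℂ)} {s : ℝ} (hs : 0 < s) {y : E3}
    (hφ : ∀ z, φ z = ρ (s⁻¹ • (z - y))) (σ : ℝ) :
    eLpNorm (fourierWeight σ (𝓕 φ : 𝓢(E3, ℂ))) 2 volume =
      ENNReal.ofReal (s ^ (3 / 2 - σ)) * eLpNorm (fourierWeight σ (𝓕 ρ : 𝓢(E3, ℂ))) 2 volume := by
  have : eLpNorm (fourierWeight σ (𝓕 φ : 𝓢(E3, ℂ))) 2 volume = eLpNorm
      ((s ^ (3 - σ) : ℝ) • fun ξ ↦ fourierWeight σ (𝓕 ρ : 𝓢(E3, ℂ)) (s • ξ)) 2 volume := by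
    refine eLpNorm_congr_norm_ae (.of_forall fun ξ ↦ ?_)
    have h3 : s ^ (3 - σ) * s ^ σ = s ^ 3 := by
      rw [← Real.rpow_add hs, ← Real.rpow_natCast]; norm_num
    simp only [fourierWeight, Pi.smul_apply, norm_smul, norm_mul, norm_fourier_dilation hs hφ]
    rw [Complex.norm_of_nonneg (by positivity), Complex.norm_of_nonneg (by positivity),
      Real.norm_of_nonneg (by positivity), Real.norm_of_nonneg hs.le,
      Real.mul_rpow hs.le (norm_nonneg ξ), ← h3]
    ring
  rw [this, eLpNorm_const_smul, eLpNorm_comp_smul _ hs, ← mul_assoc,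
    Real.enorm_of_nonneg (by positivity), ← ENNReal.ofReal_mul (by positivity), ← Real.rpow_add hs]
  congr 3
  ring

/-! ### The dual norm -/

/-- Rescaling by a positive upper bound `A`, rather than by the norm itself, avoids the case of norm
zero and the uniqueness of the density. -/
lemma enorm_apply_le_mul_dualNorm {σ : ℝ} {x : E3} {r : ℝ} (ℓ : sobolevBall σ x r →ₗ[ℂ] ℂ)
    (u : sobolevBall σ x r) {g : E3 → ℂ} (hg : HasFourierDensity (u : 𝓢'(E3, ℂ)) g) {A : ℝ}
    (hA : 0 < A) (hgA : eLpNorm (fourierWeight σ g) 2 volume ≤ ENNReal.ofReal A) :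
    ‖ℓ u‖ₑ ≤ ENNReal.ofReal A * dualNorm ℓ := by
  have hn : ‖((A⁻¹ : ℝ) : ℂ)‖ₑ = (ENNReal.ofReal A)⁻¹ := by
    rw [← ofReal_norm, Complex.norm_of_nonneg (by positivity), ENNReal.ofReal_inv_of_pos hA]
  have h1 : homSobolevNorm σ ((((A⁻¹ : ℝ) : ℂ) • u : sobolevBall σ x r) : 𝓢'(E3, ℂ)) ≤ 1 := by
    refine (iInf₂_le _ (hg.smul ((A⁻¹ : ℝ) : ℂ))).trans ?_
    rw [fourierWeight_smul, eLpNorm_const_smul, hn]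
    refine (mul_le_mul_right hgA _).trans ?_
    exact (ENNReal.inv_mul_cancel (by simpa using hA) ENNReal.ofReal_ne_top).le
  have h2 : ‖ℓ (((A⁻¹ : ℝ) : ℂ) • u)‖ₑ ≤ dualNorm ℓ :=
    le_iSup₂ (f := fun (v : sobolevBall σ x r)
      (_ : homSobolevNorm σ (v : 𝓢'(E3, ℂ)) ≤ 1) ↦ ‖ℓ v‖ₑ) _ h1
  rw [map_smul, enorm_smul, hn, mul_comm, ← div_eq_mul_inv] at h2
  rw [mul_comm]
  exact (ENNReal.div_le_iff (by simpa using hA) ENNReal.ofReal_ne_top).1 h2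

/-! ### Pointwise bounds for harmonic functions -/

/-- The mean value theorem above asks for a globally `C²` function. A cutoff equal to `1` on the
smaller ball supplies one without changing `h` there. -/
lemma InnerProductSpace.HarmonicOnNhd.exists_contDiff_extension {E F : Type*}
    [NormedAddCommGroup E] [InnerProductSpace ℝ E] [FiniteDimensional ℝ E] [NormedAddCommGroup F]
    [NormedSpace ℝ F] {h : E → F} {x : E} {R R' : ℝ} (hR' : 0 < R') (hR : R' < R)
    (hh : InnerProductSpace.HarmonicOnNhd h (ball x R)) :
    ∃ H : E → F, ContDiff ℝ 2 H ∧ Set.EqOn H h (ball x R') ∧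
      ∀ z ∈ ball x R', Laplacian.laplacian H z = 0 := by
  let χ : ContDiffBump x := ⟨R', (R' + R) / 2, hR', by linarith⟩
  have hχ : ∀ z ∈ ball x R', (fun z ↦ χ z • h z) =ᶠ[nhds z] h := fun z hz ↦ by
    filter_upwards [χ.eventuallyEq_one_of_mem_ball hz] with w hw
    simp [hw]
  refine ⟨fun z ↦ χ z • h z, contDiff_iff_contDiffAt.2 fun z ↦ ?_, fun z hz ↦ (hχ z hz).self_of_nhds,
    fun z hz ↦ ?_⟩
  · by_cases hz : z ∈ ball x R
    · exact χ.contDiffAt.smul (hh z hz).1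
    · have hz' : z ∉ tsupport χ := by
        rw [χ.tsupport_eq]
        intro h'
        rw [mem_closedBall] at h'
        rw [mem_ball, not_lt] at hz
        have : χ.rOut = (R' + R) / 2 := rfl
        linarith
      have : (fun z ↦ χ z • h z) =ᶠ[nhds z] fun _ ↦ 0 := by
        filter_upwards [notMem_tsupport_iff_eventuallyEq.1 hz'] with w hw
        simp [hw]
      exact contDiffAt_const.congr_of_eventuallyEq this
  · rw [(InnerProductSpace.laplacian_congr_nhds (hχ z hz)).self_of_nhds]
    exact (hh z (ball_subset_ball hR.le hz)).2.self_of_nhds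

/-- The profile of a radial bump function supported in the unit ball. -/
noncomputable def bumpProfile (t : ℝ) : ℝ := expNegInvGlue (1 - t)

lemma contDiff_bumpProfile {n : ℕ∞} : ContDiff ℝ n bumpProfile :=
  expNegInvGlue.contDiff.comp (contDiff_const.sub contDiff_id)

lemma bumpProfile_eq_zero {t : ℝ} (ht : 1 ≤ t) : bumpProfile t = 0 :=
  expNegInvGlue.zero_of_nonpos (by linarith)

/-- Integrating from the base point `1` makes the primitive vanish beyond `1`, so integration by
parts has no boundary term. -/
lemma exists_primitive_bumpProfile :
    ∃ f : ℝ → ℝ, (∀ t, HasDerivAt f (bumpProfile t) t) ∧ ∀ t, 1 ≤ t → f t = 0 := by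
  have hc : Continuous bumpProfile := (contDiff_bumpProfile (n := 0)).continuous
  refine ⟨fun t ↦ ∫ x in (1 : ℝ)..t, bumpProfile x,
    fun t ↦ (hc.integral_hasStrictDerivAt 1 t).hasDerivAt, fun t ht ↦ ?_⟩
  refine intervalIntegral.integral_zero_ae (.of_forall fun x hx ↦ bumpProfile_eq_zero ?_)
  rw [Set.uIoc_of_le ht] at hx
  exact hx.1.le

lemma integral_bumpProfile_pos : 0 < ∫ z : E3, bumpProfile (‖z‖ ^ 2) := by
  have hc : Continuous bumpProfile := (contDiff_bumpProfile (n := 0)).continuous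
  refine Continuous.integral_pos_of_hasCompactSupport_nonneg_nonzero (x := 0) (by fun_prop)
    (hasCompactSupport_comp_norm_sq fun t ↦ bumpProfile_eq_zero)
    (fun z ↦ expNegInvGlue.nonneg _) ?_
  simp [bumpProfile]

/-- The radial bump of radius `s` centred at `y`. -/
noncomputable def radialBump (y : E3) (s : ℝ) (z : E3) : ℂ := bumpProfile (‖s⁻¹ • (z - y)‖ ^ 2)

/-- The profile is evaluated at the squared norm, which is smooth also at the centre. -/
lemma contDiff_radialBump (y : E3) (s : ℝ) : ContDiff ℝ (⊤ : ℕ∞) (radialBump y s) := by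
  have h1 : ContDiff ℝ (⊤ : ℕ∞) fun z : E3 ↦ ‖s⁻¹ • (z - y)‖ ^ 2 :=
    ContDiff.norm_sq ℝ (ContDiff.const_smul s⁻¹ (contDiff_id.sub contDiff_const))
  have h2 : ContDiff ℝ (⊤ : ℕ∞) fun z : E3 ↦ bumpProfile (‖s⁻¹ • (z - y)‖ ^ 2) :=
    (contDiff_bumpProfile (n := ⊤)).comp h1
  exact Complex.ofRealCLM.contDiff.comp h2

lemma radialBump_eq_zero {y z : E3} {s : ℝ} (hs : 0 < s) (hz : z ∉ ball y s) :
    radialBump y s z = 0 := by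
  rw [mem_ball, not_lt, dist_eq_norm] at hz
  have : 1 ≤ ‖s⁻¹ • (z - y)‖ := by
    rw [norm_smul, norm_inv, Real.norm_of_nonneg hs.le, ← div_eq_inv_mul]
    exact (one_le_div hs).2 hz
  rw [radialBump, bumpProfile_eq_zero (by nlinarith), Complex.ofReal_zero]

lemma tsupport_radialBump_subset {y : E3} {s : ℝ} (hs : 0 < s) :
    tsupport (radialBump y s) ⊆ closedBall y s :=
  closure_minimal (fun _ hz ↦ ball_subset_closedBall <| by_contra fun h ↦
    hz (radialBump_eq_zero hs h)) isClosed_closedBall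

lemma hasCompactSupport_radialBump {y : E3} {s : ℝ} (hs : 0 < s) :
    HasCompactSupport (radialBump y s) :=
  (isCompact_closedBall y s).of_isClosed_subset (isClosed_tsupport _)
    (tsupport_radialBump_subset hs)

lemma integral_harmonic_mul_radialBump {h : E3 → ℂ} {x y : E3} {R s : ℝ} (hs : 0 < s)
    (hyR : dist y x + s < R) (hh : InnerProductSpace.HarmonicOnNhd h (ball x R)) :
    ∫ z in ball x R, h z * radialBump y s z =
      (s ^ 3 * ∫ z : E3, bumpProfile (‖z‖ ^ 2) : ℝ) * h y := by
  obtain ⟨R', h1, h2⟩ := exists_between hyR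
  obtain ⟨H, hH, hHh, hΔ⟩ :=
    hh.exists_contDiff_extension (dist_nonneg.trans_lt ((lt_add_of_pos_right _ hs).trans h1)) h2
  obtain ⟨f, hf, hf1⟩ := exists_primitive_bumpProfile
  have hsub : closedBall y s ⊆ ball x R' := closedBall_subset_ball' (by linarith)
  have hmv := integral_mul_radial_eq_of_laplacian_eq_zero hf
    (contDiff_bumpProfile (n := 0)).continuous hf1 (fun t ↦ bumpProfile_eq_zero) hH (y := y) hs.le
    (fun z hz ↦ hΔ z (hsub hz))
  calc ∫ z in ball x R, h z * radialBump y s z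
      = ∫ z, h z * radialBump y s z := by
        refine setIntegral_eq_integral_of_forall_compl_eq_zero fun z hz ↦ ?_
        rw [radialBump_eq_zero hs fun h' ↦ hz (ball_subset_ball h2.le
          (hsub (ball_subset_closedBall h'))), mul_zero]
    _ = ∫ z, H (y + s • (s⁻¹ • (z - y))) * (bumpProfile (‖s⁻¹ • (z - y)‖ ^ 2) : ℂ) := by
        refine integral_congr_ae (.of_forall fun z ↦ ?_)
        simp only [smul_inv_smul₀ hs.ne', add_sub_cancel]
        by_cases hz : z ∈ ball y s
        · rw [hHh (hsub (ball_subset_closedBall hz)), radialBump]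
        · have h0 := radialBump_eq_zero hs hz
          rw [h0, show (bumpProfile (‖s⁻¹ • (z - y)‖ ^ 2) : ℂ) = 0 from h0, mul_zero, mul_zero]
    _ = _ := by
        rw [integral_comp_inv_smul_sub
          (fun w ↦ H (y + s • w) * (bumpProfile (‖w‖ ^ 2) : ℂ)) hs y, hmv, integral_complex_ofReal,
          hHh (hsub (mem_closedBall_self hs.le)), Complex.real_smul]
        push_cast
        ring

/-- A harmonic function is bounded pointwise by its negative Sobolev norms. -/
lemma exists_enorm_harmonic_le : ∃ D : ℝ, 0 < D ∧ ∀ (σ : ℝ), 0 ≤ σ → σ ≤ 1 → ∀ (x : E3) (r : ℝ),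
    0 < r → ∀ h : E3 → ℂ, InnerProductSpace.HarmonicOnNhd h (ball x (2 * r)) →
      ∀ ℓ : sobolevBall σ x (2 * r) →ₗ[ℂ] ℂ, RepresentedBy ℓ (fun y ↦ h y / ((r ^ σ : ℝ) : ℂ)) →
        ∀ y ∈ ball x r, ‖h y‖ₑ ≤ ENNReal.ofReal (D * r ^ (-(3 / 2) : ℝ)) * dualNorm ℓ := by
  let ρ : 𝓢(E3, ℂ) :=
    (hasCompactSupport_radialBump (y := 0) one_pos).toSchwartzMap (contDiff_radialBump 0 1)
  obtain ⟨K, hK, hKρ⟩ := exists_eLpNorm_fourierWeight_le (𝓕 ρ)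
  set c : ℝ := ∫ z : E3, bumpProfile (‖z‖ ^ 2)
  have hc : 0 < c := integral_bumpProfile_pos
  -- Here `2 ^ (5 / 2)` is `2 ^ (3 / 2)`, from `(r / 2) ^ (-3 / 2)`, times the bound `2` for `2 ^
  -- σ`.
  refine ⟨2 ^ (5 / 2 : ℝ) * K / c, by positivity, fun σ h0 h1 x r hr h hh ℓ hℓ y hy ↦ ?_⟩
  set s : ℝ := r / 2 with hs_def
  have hs : 0 < s := half_pos hr
  rw [mem_ball] at hy
  let φ : 𝓢(E3, ℂ) := (hasCompactSupport_radialBump hs).toSchwartzMap (contDiff_radialBump y s)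
  have hφρ : ∀ z, φ z = ρ (s⁻¹ • (z - y)) := fun z ↦ by
    simp [φ, ρ, radialBump]
  have hφs : tsupport φ ⊆ closedBall y s := tsupport_radialBump_subset hs
  have hφb : tsupport φ ⊆ ball x (2 * r) :=
    hφs.trans (closedBall_subset_ball' (by rw [hs_def]; linarith))
  have hnorm : eLpNorm (fourierWeight σ (𝓕 φ : 𝓢(E3, ℂ))) 2 volume ≤
      ENNReal.ofReal (s ^ (3 / 2 - σ) * K) := by
    rw [eLpNorm_fourierWeight_dilation hs hφρ, ENNReal.ofReal_mul (by positivity)]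
    gcongr
    exact hKρ σ h0 h1
  have hdens := hasFourierDensity_schwartz φ
  let u : sobolevBall σ x (2 * r) := ⟨(φ : 𝓢'(E3, ℂ)),
    (iInf₂_le _ hdens).trans_lt (hnorm.trans_lt ENNReal.ofReal_lt_top),
    (dsupport_schwartz_subset φ).trans (hφb.trans ball_subset_closedBall)⟩
  have hbound := enorm_apply_le_mul_dualNorm ℓ u hdens (by positivity) hnorm
  have hval : ℓ u = (s ^ 3 * c / r ^ σ : ℝ) * h y := by
    rw [hℓ.2 φ (hasCompactSupport_radialBump hs) hφb u rfl]
    have : ∀ z, h z / ((r ^ σ : ℝ) : ℂ) * φ z =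
        ((r ^ σ : ℝ) : ℂ)⁻¹ * (h z * radialBump y s z) := fun z ↦ by
      rw [show φ z = radialBump y s z from rfl]; ring
    simp_rw [this]
    rw [integral_const_mul, integral_harmonic_mul_radialBump hs (by rw [hs_def]; linarith) hh]
    push_cast
    ring
  have ha : 0 < s ^ 3 * c / r ^ σ := by positivity
  rw [hval, enorm_mul, ← ofReal_norm ((s ^ 3 * c / r ^ σ : ℝ) : ℂ),
    Complex.norm_of_nonneg ha.le] at hbound
  have hconst : (s ^ 3 * c / r ^ σ)⁻¹ * (s ^ (3 / 2 - σ) * K) ≤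
      2 ^ (5 / 2 : ℝ) * K / c * r ^ (-(3 / 2) : ℝ) := by
    have e1 : s ^ (3 / 2 - σ) = s ^ 3 * (s ^ (-(3 / 2) : ℝ) * (s ^ σ)⁻¹) := by
      rw [← Real.rpow_natCast, ← Real.rpow_neg hs.le, ← Real.rpow_add hs, ← Real.rpow_add hs]
      norm_num; ring_nf
    have e2 : r ^ σ = 2 ^ σ * s ^ σ := by
      rw [← Real.mul_rpow (by norm_num) hs.le, hs_def]; congr 1; ring
    have e3 : s ^ (-(3 / 2) : ℝ) = 2 ^ (3 / 2 : ℝ) * r ^ (-(3 / 2) : ℝ) := by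
      rw [hs_def, Real.div_rpow hr.le (by norm_num), Real.rpow_neg (x := 2) (by norm_num)]
      field_simp
    have e4 : (2 : ℝ) ^ (5 / 2 : ℝ) = 2 * 2 ^ (3 / 2 : ℝ) := by
      rw [show (5 / 2 : ℝ) = 1 + 3 / 2 by norm_num, Real.rpow_add (by norm_num), Real.rpow_one]
    have e5 : (2 : ℝ) ^ σ ≤ 2 := by
      simpa using Real.rpow_le_rpow_of_exponent_le (x := 2) (by norm_num) h1
    have e6 : (s ^ 3 * c / r ^ σ)⁻¹ * (s ^ (3 / 2 - σ) * K) =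
        2 ^ σ * (2 ^ (3 / 2 : ℝ) * K / c * r ^ (-(3 / 2) : ℝ)) := by
      have : 0 < s ^ σ := by positivity
      rw [e1, e2, e3]
      field_simp
    rw [e6, e4]
    calc _ ≤ 2 * (2 ^ (3 / 2 : ℝ) * K / c * r ^ (-(3 / 2) : ℝ)) := by gcongr
      _ = _ := by ring
  have ha0 : ENNReal.ofReal (s ^ 3 * c / r ^ σ) ≠ 0 := by simpa using ha
  calc ‖h y‖ₑ = (ENNReal.ofReal (s ^ 3 * c / r ^ σ))⁻¹ *
        (ENNReal.ofReal (s ^ 3 * c / r ^ σ) * ‖h y‖ₑ) := by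
        rw [← mul_assoc, ENNReal.inv_mul_cancel ha0 ENNReal.ofReal_ne_top, one_mul]
    _ ≤ (ENNReal.ofReal (s ^ 3 * c / r ^ σ))⁻¹ *
        (ENNReal.ofReal (s ^ (3 / 2 - σ) * K) * dualNorm ℓ) := by gcongr
    _ = ENNReal.ofReal ((s ^ 3 * c / r ^ σ)⁻¹ * (s ^ (3 / 2 - σ) * K)) * dualNorm ℓ := by
        rw [← mul_assoc, ENNReal.ofReal_mul (inv_nonneg.2 ha.le), ENNReal.ofReal_inv_of_pos ha]
    _ ≤ _ := by gcongr

/-! ### From the pointwise bound to the `L²` bound -/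

lemma volume_ball_rpow_half (x : E3) {r : ℝ} (hr : 0 < r) :
    volume (ball x r) ^ (1 / 2 : ℝ) =
      ENNReal.ofReal (r ^ (3 / 2 : ℝ)) * volume (ball (0 : E3) 1) ^ (1 / 2 : ℝ) := by
  rw [Measure.addHaar_ball_of_pos volume x hr, ENNReal.mul_rpow_of_nonneg _ _ (by norm_num),
    ENNReal.ofReal_rpow_of_nonneg (by positivity) (by norm_num)]
  congr 2
  rw [← Real.rpow_natCast, ← Real.rpow_mul hr.le]
  simp
  norm_num

theorem lemma4p1 :
    ∃ C : ℝ≥0, 0 < C ∧ ∀ (σ : ℝ), 0 ≤ σ → σ ≤ 1 → ∀ (x₀ : E3) (r : ℝ), 0 < r →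
      ∀ h : E3 → ℂ, InnerProductSpace.HarmonicOnNhd h (ball x₀ (2 * r)) →
        eLpNorm h 2 (volume.restrict (ball x₀ r)) ≤
          C * negSobolevNorm σ x₀ (2 * r) (fun y ↦ h y / ((r ^ σ : ℝ) : ℂ)) := by
  obtain ⟨D, hD, hbound⟩ := exists_enorm_harmonic_le
  set V : ℝ≥0∞ := volume (ball (0 : E3) 1) ^ (1 / 2 : ℝ) with hV_def
  have hV : V ≠ ∞ := ENNReal.rpow_ne_top_of_nonneg (by norm_num) measure_ball_lt_top.ne
  have hV0 : V ≠ 0 := by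
    simpa [hV_def, ENNReal.rpow_eq_zero_iff] using (measure_ball_pos volume (0 : E3) one_pos).ne'
  have hCtop : ENNReal.ofReal D * V ≠ ∞ := ENNReal.mul_ne_top ENNReal.ofReal_ne_top hV
  have hC0 : ENNReal.ofReal D * V ≠ 0 := mul_ne_zero (by simpa using hD) hV0
  refine ⟨(ENNReal.ofReal D * V).toNNReal, ENNReal.toNNReal_pos hC0 hCtop,
    fun σ h0 h1 x r hr h hh ↦ ?_⟩
  -- With the constant moved to the left, the infimum stands alone on the right and it suffices to
  -- treat each representing functional `ℓ`.
  rw [ENNReal.coe_toNNReal hCtop, mul_comm, ← ENNReal.div_le_iff hC0 hCtop]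
  refine le_iInf₂ fun ℓ hℓ ↦ ?_
  rw [ENNReal.div_le_iff hC0 hCtop]
  set B := ENNReal.ofReal (D * r ^ (-(3 / 2) : ℝ)) * dualNorm ℓ with hB
  calc eLpNorm h 2 (volume.restrict (ball x r))
      ≤ eLpNorm (fun _ : E3 ↦ B) 2 (volume.restrict (ball x r)) := by
        refine eLpNorm_mono_enorm_ae ?_
        filter_upwards [ae_restrict_mem measurableSet_ball] with y hy
        simpa using hbound σ h0 h1 x r hr h hh ℓ hℓ y hy
    _ = B * (ENNReal.ofReal (r ^ (3 / 2 : ℝ)) * V) := by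
        rw [eLpNorm_const' _ (by norm_num) (by norm_num), Measure.restrict_apply_univ,
          ← volume_ball_rpow_half x hr]
        simp
    _ = ENNReal.ofReal (D * r ^ (-(3 / 2) : ℝ) * r ^ (3 / 2 : ℝ)) * V * dualNorm ℓ := by
        rw [hB, ENNReal.ofReal_mul (by positivity : 0 ≤ D * r ^ (-(3 / 2) : ℝ))]
        ring
    _ = dualNorm ℓ * (ENNReal.ofReal D * V) := by
        rw [mul_assoc D, ← Real.rpow_add hr]
        simp [mul_comm]
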